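/- Consider the fourth-order ordinary differential equation (obtained, with $s=\log r$, from $O(5)$-equivariant biharmonic maps $\mathbf{R}^5\to S^5$) $$\phi^{(4)} = (4\cos(2\phi)+9)\,\phi'' - 12\sin(2\phi) + \bigl(6\phi''-4\sin(2\phi)\bigr)(\phi')^2 + (4\cos(2\phi)+10)\,\phi' + 2(\phi')^3 - 2\phi^{(3)}. \qquad (*)$$ Let $W^u(0)\subset\mathbf{R}^4$ be the unstable manifold of the origin for the associated first-order system in $(\phi,\phi',\phi'',\phi^{(3)})$, that is, the set of all points whose backward solution exists on $(-\infty,0]$ and converges to $0$ as $s\to-\infty$. Define $\mathcal{F}:[0,\pi]\to\mathbf{R}$ by $\mathcal{F}(x)=2\sqrt6\,\sin x$ for $x\in[0,\pi/2]$ and $\mathcal{F}(x)=2\sqrt6$ for $x\in(\pi/2,\pi]$, and let $$\mathcal{C}=\{(x,y)\in\mathbf{R}^2 : 0<x<\pi \text{ and } -\mathcal{F}(\pi-x)<y<\mathcal{F}(x)\}.$$ Then there exists $\phi\in C^\infty(\mathbf{R};\mathbf{R})$ that solves $(*)$ on $\mathbf{R}$ and lies in $W^u(0)$, i.e. $(\phi(s),\phi'(s),\phi''(s),\phi^{(3)}(s))\in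 W^u(0)$ for all $s\in\mathbf{R}$, such that $(\phi(s),\phi''(s))\in\mathcal{C}$ for all $s\in\mathbf{R}$, and $$(\phi(s),\phi'(s),\phi''(s),\phi^{(3)}(s))\to(\pi/2,0,0,0)\quad\text{as } s\to\infty.$$ -/

import Mathlib

open Filter Topology
open scoped ContDiff

/-- The right-hand side of the scalar fourth-order equation
`φ⁗ = fourthOrderRHS φ φ' φ'' φ'''` in dimension `d = 5`. -/
noncomputable def fourthOrderRHS (x₀ x₁ x₂ x₃ : ℝ) : ℝ :=
  (4 * Real.cos (2 * x₀) + 9) * x₂ - 12 * Real.sin (2 * x₀)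
    + (6 * x₂ - 4 * Real.sin (2 * x₀)) * x₁ ^ 2
    + (4 * Real.cos (2 * x₀) + 10) * x₁
    + 2 * x₁ ^ 3 - 2 * x₃

/-- The vector field on `ℝ⁴` of the associated first-order system in `(φ, φ', φ'', φ''')`. -/
noncomputable def phaseField (x : Fin 4 → ℝ) : Fin 4 → ℝ :=
  ![x 1, x 2, x 3, fourthOrderRHS (x 0) (x 1) (x 2) (x 3)]

/-- `φ` solves the fourth-order equation on all of `ℝ` (used for smooth `φ`). -/
def IsEntireSolution (φ : ℝ → ℝ) : Prop :=
  ∀ s : ℝ, iteratedDeriv 4 φ s =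
    fourthOrderRHS (φ s) (iteratedDeriv 1 φ s) (iteratedDeriv 2 φ s) (iteratedDeriv 3 φ s)

/-- The phase-space curve `s ↦ (φ(s), φ'(s), φ''(s), φ'''(s))`. -/
noncomputable def phaseCurve (φ : ℝ → ℝ) (s : ℝ) : Fin 4 → ℝ :=
  ![φ s, iteratedDeriv 1 φ s, iteratedDeriv 2 φ s, iteratedDeriv 3 φ s]

/-- The (global) unstable manifold of a point `p` for the autonomous system `x' = V x`: all points
`x` whose backward solution exists on `(-∞, 0]` and converges to `p` at `-∞`. -/
def unstableManifold {E : Type*} [NormedAddCommGroup E] [NormedSpace ℝ E]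
    (V : E → E) (p : E) : Set E :=
  {x | ∃ γ : ℝ → E, γ 0 = x ∧
    (∀ t ≤ 0, HasDerivWithinAt γ (V (γ t)) (Set.Iic 0) t) ∧ Tendsto γ atBot (𝓝 p)}

/-- The function `𝓕` on `[0, π]`; its values elsewhere are never used. -/
noncomputable def boundaryF (x : ℝ) : ℝ :=
  if x ≤ Real.pi / 2 then 2 * √6 * Real.sin x else 2 * √6

/-- The region `𝓒` of the `(φ, φ'')`-plane. -/
def regionC : Set (ℝ × ℝ) :=
  {p | 0 < p.1 ∧ p.1 < Real.pi ∧ -boundaryF (Real.pi - p.1) < p.2 ∧ p.2 < boundaryF p.1}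

/-! Write x, p, y, z for the coordinates φ, φ', φ'', φ'''. Along solutions `energy` is
nondecreasing, and constant only at equilibria, where p = y = z = 0 and sin 2x = 0. Its value is -6
at x = 0 and x = π, and 6 at x = π/2. Hence an orbit that starts above level -6 and stays over the
closed region has nowhere to converge but x = π/2 (`tendsto_atTop_of_mem_closedRegion`).

The region is adapted to this energy: y²/2 = 12 sin² x on the curved upper boundary, and above level
-6 this forces p > 0 wherever an orbit first reaches the right or upper boundary. A
second-derivative test shows that the orbit then leaves the closed region at once. The symmetry φ ↦
π - φ gives p < 0 on the left and lower boundary. Immediate exit makes the exit time continuous in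
the initial point. Along an arc near 0 whose two ends exit on opposite sides, p at exit would be
continuous, nonzero and of both signs, so some orbit never exits (`exists_forall_mem_openRegion`).

No linearisation at 0 is used to reach the unstable manifold. Arcs shrinking to 0 give trapped
orbits that need arbitrarily long to reach norm 1; with time shifted so that norm 1 is first reached
at time 0, compactness yields an entire trapped orbit with norm at most 1 for t ≤ 0
(`exists_entire_orbit`). The origin is the only equilibrium available in that ball, so the orbit
emanates from it. It lies strictly above level -6 (`energy_gt_of_mem_trappingSet`), hence cannot
touch the boundary and tends to x = π/2.

The cubic field need not have global solutions, so everything runs in the flow of a truncated field.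
A priori bounds keep trapped orbits where the truncation has no effect. -/

section Flow

/-! ### Global flows of bounded Lipschitz fields -/

variable {E : Type*} [NormedAddCommGroup E] [NormedSpace ℝ E]

/-- `Φ x` is the solution of `y' = v y` with `y 0 = x`, for every starting point `x`. -/
structure IsGlobalFlow (v : E → E) (Φ : E → ℝ → E) : Prop where
  zero : ∀ x, Φ x 0 = x
  hasDerivAt : ∀ x t, HasDerivAt (Φ x) (v (Φ x t)) t

theorem exists_isGlobalFlow [CompleteSpace E] {v : E → E} {K L : NNReal}
    (hK : LipschitzWith K v) (hL : ∀ x, ‖v x‖ ≤ L) : ∃ Φ : E → ℝ → E, IsGlobalFlow v Φ := by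
  have local_sol : ∀ (x : E) (n : ℕ), ∃ α : ℝ → E, α 0 = x ∧
      ∀ t ∈ Set.Ioo (-(n + 1 : ℝ)) (n + 1), HasDerivAt α (v (α t)) t := by
    intro x n
    have h0 : (0 : ℝ) ∈ Set.Icc (-(n + 1 : ℝ)) (n + 1) := ⟨by linarith [n.cast_nonneg (α := ℝ)],
      by positivity⟩
    -- Speed at most L keeps the solution in the ball of radius L(n + 1), so the time interval may
    -- be as long as desired.
    have hpl : IsPicardLindelof (fun _ ↦ v) (⟨0, h0⟩ : Set.Icc (-(n + 1 : ℝ)) (n + 1)) x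
        (L * (n + 1)) 0 L K :=
      IsPicardLindelof.of_time_independent (fun y _ ↦ hL y) hK.lipschitzOnWith (by simp)
    obtain ⟨α, h1, h2⟩ := hpl.exists_eq_forall_mem_Icc_hasDerivWithinAt₀
    exact ⟨α, h1, fun t ht ↦ (h2 t ⟨ht.1.le, ht.2.le⟩).hasDerivAt (Icc_mem_nhds ht.1 ht.2)⟩
  choose α h0 hα using local_sol
  have agree : ∀ x (m n : ℕ), m ≤ n →
      Set.EqOn (α x m) (α x n) (Set.Ioo (-(m + 1 : ℝ)) (m + 1)) := by
    intro x m n hmn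
    have hmn' : (m : ℝ) ≤ n := by exact_mod_cast hmn
    refine ODE_solution_unique_of_mem_Ioo (v := fun _ ↦ v) (s := fun _ ↦ Set.univ) (K := K)
      (t₀ := 0) (fun _ _ ↦ hK.lipschitzOnWith)
      ⟨by linarith [m.cast_nonneg (α := ℝ)], by positivity⟩
      (fun t ht ↦ ⟨hα x m t ht, trivial⟩)
      (fun t ht ↦ ⟨hα x n t ⟨by linarith [ht.1], by linarith [ht.2]⟩, trivial⟩)
      (by rw [h0, h0])
  -- The index jumps at integer times; near t every value agrees with the single solution of index
  -- ⌈|t|⌉₊ + 1, which gives differentiability there.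
  refine ⟨fun x t ↦ α x ⌈|t|⌉₊ t, fun x ↦ h0 _ _, fun x t ↦ ?_⟩
  have key : ∀ s : ℝ, |s| < ⌈|t|⌉₊ + 1 → α x ⌈|s|⌉₊ s = α x (⌈|t|⌉₊ + 1) s := by
    intro s hs
    refine agree x _ _ ?_ ?_
    · exact Nat.ceil_le.2 (by push_cast; exact hs.le)
    · exact abs_lt.1 ((Nat.le_ceil _).trans_lt (lt_add_one _))
  have ht : |t| < ⌈|t|⌉₊ + 1 := (Nat.le_ceil _).trans_lt (lt_add_one _)
  have hev : (fun s ↦ α x ⌈|s|⌉₊ s) =ᶠ[𝓝 t] α x (⌈|t|⌉₊ + 1) := by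
    filter_upwards [(isOpen_lt continuous_abs continuous_const).mem_nhds ht] with s hs
    exact key s hs
  have := hα x (⌈|t|⌉₊ + 1) t (by
    push_cast
    exact abs_lt.1 (ht.trans (lt_add_one _)))
  rw [← key t ht] at this
  exact this.congr_of_eventuallyEq hev

namespace IsGlobalFlow

variable {v : E → E} {Φ : E → ℝ → E} {K : NNReal}

theorem continuous (h : IsGlobalFlow v Φ) (x : E) : Continuous (Φ x) :=
  continuous_iff_continuousAt.2 fun t ↦ (h.hasDerivAt x t).continuousAt

theorem eq_of_hasDerivAt (h : IsGlobalFlow v Φ) (hK : LipschitzWith K v) {y : ℝ → E}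
    (hy : ∀ t, HasDerivAt y (v (y t)) t) : y = Φ (y 0) :=
  ODE_solution_unique_univ (v := fun _ ↦ v) (s := fun _ ↦ Set.univ) (K := K) (t₀ := 0)
    (fun _ ↦ hK.lipschitzOnWith) (fun t ↦ ⟨hy t, trivial⟩) (fun t ↦ ⟨h.hasDerivAt _ t, trivial⟩)
    (h.zero _).symm

theorem add (h : IsGlobalFlow v Φ) (hK : LipschitzWith K v) (x : E) (s t : ℝ) :
    Φ x (s + t) = Φ (Φ x s) t := by
  have := h.eq_of_hasDerivAt hK (y := fun t ↦ Φ x (s + t)) (fun t ↦ by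
    simpa using HasDerivAt.comp_const_add s t (h.hasDerivAt x (s + t)))
  simpa using congrFun this t

theorem dist_le (h : IsGlobalFlow v Φ) (hK : LipschitzWith K v) (x y : E) (t : ℝ) :
    dist (Φ x t) (Φ y t) ≤ dist x y * Real.exp (K * |t|) := by
  have forward : ∀ {w : E → E} {f g : ℝ → E}, LipschitzWith K w →
      (∀ t, HasDerivAt f (w (f t)) t) → (∀ t, HasDerivAt g (w (g t)) t) → ∀ t, 0 ≤ t →
      dist (f t) (g t) ≤ dist (f 0) (g 0) * Real.exp (K * t) := by
    intro w f g hw hf hg t ht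
    have := dist_le_of_trajectories_ODE (v := fun _ ↦ w) (K := K) (a := 0) (b := t)
      (fun _ ↦ hw) (fun s _ ↦ (hf s).continuousAt.continuousWithinAt)
      (fun s _ ↦ (hf s).hasDerivWithinAt) (fun s _ ↦ (hg s).continuousAt.continuousWithinAt)
      (fun s _ ↦ (hg s).hasDerivWithinAt) le_rfl t ⟨ht, le_rfl⟩
    simpa using this
  rcases le_total 0 t with ht | ht
  · have := forward hK (h.hasDerivAt x) (h.hasDerivAt y) t ht
    simpa [h.zero, abs_of_nonneg ht] using this
  · have hneg : ∀ x t, HasDerivAt (fun s ↦ Φ x (-s)) ((-v) (Φ x (-t))) t := fun x t ↦ by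
      simpa [Function.comp_def] using HasDerivAt.scomp t (h.hasDerivAt x (-t)) (hasDerivAt_neg t)
    have := forward hK.neg (hneg x) (hneg y) (-t) (by linarith)
    simpa [h.zero, abs_of_nonpos ht] using this

theorem continuous_uncurry (h : IsGlobalFlow v Φ) (hK : LipschitzWith K v) :
    Continuous (fun q : E × ℝ ↦ Φ q.1 q.2) := by
  rw [continuous_iff_continuousAt]
  rintro ⟨x, t⟩
  rw [ContinuousAt, tendsto_iff_dist_tendsto_zero]
  have hb : Tendsto (fun q : E × ℝ ↦ dist q.1 x * Real.exp (K * |q.2|) + dist (Φ x q.2) (Φ x t))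
      (𝓝 (x, t)) (𝓝 0) := by
    have hc : Continuous (fun q : E × ℝ ↦
        dist q.1 x * Real.exp (K * |q.2|) + dist (Φ x q.2) (Φ x t)) := by
      have := h.continuous x
      fun_prop
    simpa using hc.tendsto (x, t)
  refine squeeze_zero (fun _ ↦ dist_nonneg) (fun q ↦ ?_) hb
  exact (dist_triangle _ (Φ x q.2) _).trans (add_le_add_left (h.dist_le hK _ _ _) _)

theorem continuous_left (h : IsGlobalFlow v Φ) (hK : LipschitzWith K v) (t : ℝ) :
    Continuous (fun x ↦ Φ x t) :=
  (h.continuous_uncurry hK).comp (by fun_prop : Continuous fun x : E ↦ (x, t))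

end IsGlobalFlow

end Flow
/-! ### The vector field and its truncation -/

theorem contDiff_phaseField : ContDiff ℝ ∞ phaseField := by
  rw [contDiff_pi]
  intro i
  fin_cases i <;> simp only [phaseField, fourthOrderRHS] <;> simp <;> fun_prop

/-- Coordinatewise truncation to `[-4000, 4000]`. -/
noncomputable def clampBox (X : Fin 4 → ℝ) : Fin 4 → ℝ := fun i ↦ max (-4000) (min 4000 (X i))

theorem clampBox_eq {X : Fin 4 → ℝ} (h : ∀ i, |X i| ≤ 4000) : clampBox X = X := by
  ext i
  have := abs_le.1 (h i)
  rw [clampBox, min_eq_right this.2, max_eq_right this.1]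

theorem clampBox_mem (X : Fin 4 → ℝ) :
    clampBox X ∈ Set.Icc (fun _ ↦ -4000 : Fin 4 → ℝ) (fun _ ↦ 4000) :=
  ⟨fun _ ↦ le_max_left _ _, fun _ ↦ max_le (by norm_num) (min_le_left _ _)⟩

theorem lipschitzWith_clampBox : LipschitzWith 1 clampBox := by
  refine LipschitzWith.of_dist_le_mul fun X Y ↦ ?_
  rw [NNReal.coe_one, one_mul, dist_pi_le_iff dist_nonneg]
  intro i
  refine le_trans ?_ (dist_le_pi_dist X Y i)
  rw [Real.dist_eq, Real.dist_eq, clampBox, clampBox]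
  refine (abs_max_sub_max_le_max _ _ _ _).trans ?_
  rw [sub_self, abs_zero, max_eq_right (abs_nonneg _)]
  refine (abs_min_sub_min_le_max _ _ _ _).trans ?_
  rw [sub_self, abs_zero, max_eq_right (abs_nonneg _)]

/-- The vector field of the fourth-order equation, frozen outside a large box. -/
noncomputable def truncField (X : Fin 4 → ℝ) : Fin 4 → ℝ := phaseField (clampBox X)

theorem truncField_eq {X : Fin 4 → ℝ} (h : ∀ i, |X i| ≤ 4000) : truncField X = phaseField X := by
  rw [truncField, clampBox_eq h]

theorem exists_lipschitzWith_truncField : ∃ K, LipschitzWith K truncField := by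
  obtain ⟨K, hK⟩ := contDiff_phaseField.contDiffOn.exists_lipschitzOnWith
    (s := Set.Icc (fun _ ↦ -4000 : Fin 4 → ℝ) (fun _ ↦ 4000)) (by simp) (convex_Icc _ _)
    isCompact_Icc
  have := hK.comp (lipschitzWith_clampBox.lipschitzOnWith (s := Set.univ))
    (fun X _ ↦ clampBox_mem X)
  exact ⟨K * 1, lipschitzOnWith_univ.1 this⟩

theorem exists_bound_truncField : ∃ L : NNReal, ∀ X, ‖truncField X‖ ≤ L := by
  obtain ⟨C, hC⟩ := (isCompact_Icc (a := (fun _ ↦ -4000 : Fin 4 → ℝ))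
    (b := fun _ ↦ 4000)).exists_bound_of_continuousOn contDiff_phaseField.continuous.continuousOn
  exact ⟨C.toNNReal, fun X ↦ (hC _ (clampBox_mem X)).trans (Real.le_coe_toNNReal C)⟩

/-! ### The monotone energy -/

/-- A quantity that does not decrease along solutions. -/
noncomputable def energy (X : Fin 4 → ℝ) : ℝ :=
  X 1 * X 3 - X 2 ^ 2 / 2 + 2 * X 2 * X 1 - (9 / 2 + 2 * Real.cos (2 * X 0)) * X 1 ^ 2
    - 6 * Real.cos (2 * X 0) - 3 / 2 * X 1 ^ 4

/-- The derivative of `energy` along solutions. The coefficient of the squared velocity is at least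
6. -/
noncomputable def dissipation (X : Fin 4 → ℝ) : ℝ :=
  2 * X 2 ^ 2 + (4 * Real.cos (2 * X 0) + 10) * X 1 ^ 2 + 2 * X 1 ^ 4

theorem continuous_energy : Continuous energy := by
  unfold energy; fun_prop

theorem dissipation_nonneg (X : Fin 4 → ℝ) : 0 ≤ dissipation X := by
  have := Real.neg_one_le_cos (2 * X 0)
  have h : 0 ≤ 4 * Real.cos (2 * X 0) + 10 := by linarith
  unfold dissipation; positivity

theorem eq_zero_of_dissipation_eq_zero {X : Fin 4 → ℝ} (h : dissipation X = 0) :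
    X 1 = 0 ∧ X 2 = 0 := by
  have hc := Real.neg_one_le_cos (2 * X 0)
  have h1 : 0 ≤ (4 * Real.cos (2 * X 0) + 10 - 6) * X 1 ^ 2 :=
    mul_nonneg (by linarith) (sq_nonneg _)
  unfold dissipation at h
  have h4 : 0 ≤ X 1 ^ 4 := by positivity
  constructor <;> refine pow_eq_zero_iff (two_ne_zero) |>.1 ?_ <;>
    nlinarith [sq_nonneg (X 1), sq_nonneg (X 2)]

theorem hasDerivAt_coord {X : ℝ → Fin 4 → ℝ} {t : ℝ} (h : HasDerivAt X (phaseField (X t)) t) :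
    HasDerivAt (fun s ↦ X s 0) (X t 1) t ∧ HasDerivAt (fun s ↦ X s 1) (X t 2) t ∧
    HasDerivAt (fun s ↦ X s 2) (X t 3) t ∧
    HasDerivAt (fun s ↦ X s 3) (fourthOrderRHS (X t 0) (X t 1) (X t 2) (X t 3)) t := by
  rw [hasDerivAt_pi] at h
  exact ⟨by simpa [phaseField] using h 0, by simpa [phaseField] using h 1,
    by simpa [phaseField] using h 2, by simpa [phaseField] using h 3⟩

theorem hasDerivAt_energy {X : ℝ → Fin 4 → ℝ} {t : ℝ} (h : HasDerivAt X (phaseField (X t)) t) :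
    HasDerivAt (fun s ↦ energy (X s)) (dissipation (X t)) t := by
  obtain ⟨h0, h1, h2, h3⟩ := hasDerivAt_coord h
  have hc := (h0.const_mul 2).cos
  have := (((((h1.mul h3).sub ((h2.pow 2).div_const 2)).add ((h2.const_mul 2).mul h1)).sub
    (((hc.const_mul 2).const_add (9 / 2)).mul (h1.pow 2))).sub (hc.const_mul 6)).sub
    ((h1.pow 4).const_mul (3 / 2))
  refine (this.congr_deriv ?_).congr_of_eventuallyEq (.of_forall fun s ↦ ?_)
  · simp only [dissipation, fourthOrderRHS, Pi.pow_apply]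
    push_cast
    ring
  · simp only [energy, Pi.pow_apply, Pi.mul_apply, Pi.sub_apply, Pi.add_apply]

/-! ### The region -/

/-- The part of phase space over `regionC`. -/
def openRegion : Set (Fin 4 → ℝ) := {X | (X 0, X 2) ∈ regionC}

/-- The part of phase space over the closure of `regionC`. -/
def closedRegion : Set (Fin 4 → ℝ) :=
  {X | 0 ≤ X 0 ∧ X 0 ≤ Real.pi ∧ -boundaryF (Real.pi - X 0) ≤ X 2 ∧ X 2 ≤ boundaryF (X 0)}

/-- A formula without cases, from which continuity is immediate. -/
theorem boundaryF_eq (x : ℝ) : boundaryF x = 2 * √6 * Real.sin (min x (Real.pi / 2)) := by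
  unfold boundaryF
  split_ifs with h
  · rw [min_eq_left h]
  · rw [min_eq_right (not_le.1 h).le, Real.sin_pi_div_two, mul_one]

theorem continuous_boundaryF : Continuous boundaryF := by
  rw [funext boundaryF_eq]; fun_prop

theorem boundaryF_le (x : ℝ) : boundaryF x ≤ 2 * √6 := by
  rw [boundaryF_eq]
  exact mul_le_of_le_one_right (by positivity) (Real.sin_le_one _)

theorem two_sqrt_six_lt : 2 * √6 < 5 := by
  have : √6 < 5 / 2 := (Real.sqrt_lt' (by norm_num)).2 (by norm_num)
  linarith

theorem isOpen_openRegion : IsOpen openRegion := by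
  have h := continuous_boundaryF
  change IsOpen {X : Fin 4 → ℝ | 0 < X 0 ∧ X 0 < Real.pi ∧ -boundaryF (Real.pi - X 0) < X 2 ∧
    X 2 < boundaryF (X 0)}
  refine .and ?_ (.and ?_ (.and ?_ ?_)) <;> refine isOpen_lt ?_ ?_ <;> fun_prop

theorem isClosed_closedRegion : IsClosed closedRegion := by
  have h := continuous_boundaryF
  unfold closedRegion
  simp only [Set.ofPred_and]
  refine .inter ?_ (.inter ?_ (.inter ?_ ?_)) <;> refine isClosed_le ?_ ?_ <;> fun_prop

theorem openRegion_subset : openRegion ⊆ closedRegion :=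
  fun _ h ↦ ⟨h.1.le, h.2.1.le, h.2.2.1.le, h.2.2.2.le⟩

/-! ### A priori bounds -/

/-- A box containing all orbits of interest. -/
def innerBox : Set (Fin 4 → ℝ) := {X | |X 0| ≤ 4 ∧ |X 1| ≤ 10 ∧ |X 2| ≤ 5 ∧ |X 3| ≤ 3000}

theorem isCompact_innerBox : IsCompact innerBox := by
  refine Metric.isCompact_of_isClosed_isBounded ?_ ?_
  · unfold innerBox
    simp only [Set.ofPred_and]
    refine .inter ?_ (.inter ?_ (.inter ?_ ?_)) <;> refine isClosed_le ?_ ?_ <;> fun_prop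
  · refine (Metric.isBounded_closedBall (x := 0) (r := 3000)).subset fun X hX ↦ ?_
    obtain ⟨h0, h1, h2, h3⟩ := hX
    rw [mem_closedBall_zero_iff, pi_norm_le_iff_of_nonneg (by norm_num)]
    intro i
    rw [Real.norm_eq_abs]
    fin_cases i <;> simp <;> linarith

theorem truncField_eventuallyEq_of_mem_innerBox {X : Fin 4 → ℝ} (h : X ∈ innerBox) :
    truncField =ᶠ[𝓝 X] phaseField := by
  obtain ⟨h0, h1, h2, h3⟩ := h
  have : ∀ᶠ Y : Fin 4 → ℝ in 𝓝 X, ∀ i, |Y i| < 4000 := by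
    rw [eventually_all]
    intro i
    refine (isOpen_lt (by fun_prop) continuous_const).mem_nhds ?_
    fin_cases i <;> simp <;> linarith
  filter_upwards [this] with Y hY
  exact truncField_eq fun i ↦ (hY i).le

theorem closedRegion_bounds {X : Fin 4 → ℝ} (h : X ∈ closedRegion) :
    0 ≤ X 0 ∧ X 0 ≤ 4 ∧ |X 2| ≤ 5 := by
  obtain ⟨h0, h1, h2, h3⟩ := h
  have ha := boundaryF_le (X 0)
  have hb := boundaryF_le (Real.pi - X 0)
  have := two_sqrt_six_lt
  exact ⟨h0, h1.trans Real.pi_lt_four.le, abs_le.2 ⟨by linarith, by linarith⟩⟩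

/-- A barrier argument: a level at which f is always strictly decreasing cannot be crossed upward.
-/
theorem le_of_deriv_neg_at_level {f f' : ℝ → ℝ} {T M : ℝ} (hf : ∀ t, HasDerivAt f (f' t) t)
    (h0 : f 0 ≤ M) (h : ∀ t ∈ Set.Icc 0 T, f t = M → f' t < 0) :
    ∀ t ∈ Set.Icc 0 T, f t ≤ M := fun _ ht ↦
  image_le_of_deriv_right_lt_deriv_boundary (B := fun _ ↦ M) (B' := fun _ ↦ 0)
    (fun t _ ↦ (hf t).continuousAt.continuousWithinAt) (fun t _ ↦ (hf t).hasDerivWithinAt) h0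
    (fun t ↦ hasDerivAt_const t M) (fun t ht ↦ h t ⟨ht.1, ht.2.le⟩) ht

theorem abs_fourthOrderRHS_add_le {x p y z : ℝ} (hp : |p| ≤ 10) (hy : |y| ≤ 5) :
    |fourthOrderRHS x p y z + 2 * z| ≤ 5900 := by
  have hc := Real.abs_cos_le_one (2 * x)
  have hs := Real.abs_sin_le_one (2 * x)
  have e : fourthOrderRHS x p y z + 2 * z = (4 * Real.cos (2 * x) + 9) * y
      - 12 * Real.sin (2 * x) + (6 * y - 4 * Real.sin (2 * x)) * p ^ 2
      + (4 * Real.cos (2 * x) + 10) * p + 2 * p ^ 3 := by unfold fourthOrderRHS; ring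
  rw [e]
  have h1 : |(4 * Real.cos (2 * x) + 9) * y| ≤ 13 * 5 := by
    rw [abs_mul]
    gcongr
    rw [abs_le] at hc ⊢
    constructor <;> linarith
  have h2 : |12 * Real.sin (2 * x)| ≤ 12 := by
    rw [abs_mul, abs_of_pos (by norm_num : (0 : ℝ) < 12)]; linarith
  have h3 : |(6 * y - 4 * Real.sin (2 * x)) * p ^ 2| ≤ 34 * 10 ^ 2 := by
    rw [abs_mul, abs_pow]
    gcongr
    rw [abs_le] at hs hy ⊢
    constructor <;> linarith
  have h4 : |(4 * Real.cos (2 * x) + 10) * p| ≤ 14 * 10 := by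
    rw [abs_mul]
    gcongr
    rw [abs_le] at hc ⊢
    constructor <;> linarith
  have h5 : |2 * p ^ 3| ≤ 2 * 10 ^ 3 := by
    rw [abs_mul, abs_pow, abs_of_pos (by norm_num : (0 : ℝ) < 2)]
    gcongr
  rw [abs_le] at *
  constructor <;> linarith

/-- An orbit of the truncated field that lies over the closed region stays in `innerBox`, where
the truncation is not felt. -/
theorem mem_innerBox_of_mem_closedRegion {X : ℝ → Fin 4 → ℝ} {T : ℝ}
    (hX : ∀ t, HasDerivAt X (truncField (X t)) t)
    (h1 : |X 0 1| ≤ 1) (h3 : |X 0 3| ≤ 3000) (hC : ∀ t ∈ Set.Icc 0 T, X t ∈ closedRegion) :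
    ∀ t ∈ Set.Icc 0 T, X t ∈ innerBox := by
  intro t ht
  have hb : ∀ t ∈ Set.Icc 0 T, 0 ≤ X t 0 ∧ X t 0 ≤ 4 ∧ |X t 2| ≤ 5 :=
    fun t ht ↦ closedRegion_bounds (hC t ht)
  have hb0 := hb 0 ⟨le_rfl, ht.1.trans ht.2⟩
  have d0 : ∀ t, HasDerivAt (fun s ↦ X s 0) (clampBox (X t) 1) t := fun t ↦ by
    simpa [truncField, phaseField] using hasDerivAt_pi.1 (hX t) 0
  have d1 : ∀ t, HasDerivAt (fun s ↦ X s 1) (clampBox (X t) 2) t := fun t ↦ by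
    simpa [truncField, phaseField] using hasDerivAt_pi.1 (hX t) 1
  have d3 : ∀ t, HasDerivAt (fun s ↦ X s 3) (fourthOrderRHS (clampBox (X t) 0)
      (clampBox (X t) 1) (clampBox (X t) 2) (clampBox (X t) 3)) t := fun t ↦ by
    simpa [truncField, phaseField] using hasDerivAt_pi.1 (hX t) 3
  have c2 : ∀ t ∈ Set.Icc 0 T, |clampBox (X t) 2| ≤ 5 := fun t ht ↦ by
    have := abs_le.1 (hb t ht).2.2
    rw [clampBox, min_eq_right (by linarith), max_eq_right (by linarith)]
    exact (hb t ht).2.2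
  rw [abs_le] at h1 h3
  -- The bound on y alone does not bound p, but x is bounded too. When p - x = 6 one has p ≥ 6, so
  -- (p - x)' = y - p ≤ 5 - 6 < 0; `p2` is the mirror estimate.
  have p1 : ∀ t ∈ Set.Icc 0 T, X t 1 - X t 0 ≤ 6 := by
    refine le_of_deriv_neg_at_level (fun t ↦ (d1 t).sub (d0 t)) (by linarith) fun t ht h ↦ ?_
    have := abs_le.1 (c2 t ht)
    have := (hb t ht).1
    have : 6 ≤ clampBox (X t) 1 :=
      le_max_of_le_right (le_min (by norm_num) (by linarith))
    linarith
  have p2 : ∀ t ∈ Set.Icc 0 T, X t 0 - X t 1 ≤ 10 := by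
    refine le_of_deriv_neg_at_level (fun t ↦ (d0 t).sub (d1 t)) (by linarith) fun t ht h ↦ ?_
    have := abs_le.1 (c2 t ht)
    have := (hb t ht).2.1
    have : clampBox (X t) 1 ≤ -6 :=
      max_le (by norm_num) (min_le_of_right_le (by linarith))
    linarith
  have q : ∀ t ∈ Set.Icc 0 T, |X t 1| ≤ 10 := fun t ht ↦ by
    have := p1 t ht; have := p2 t ht; have := hb t ht
    exact abs_le.2 ⟨by linarith, by linarith⟩
  have c1 : ∀ t ∈ Set.Icc 0 T, |clampBox (X t) 1| ≤ 10 := fun t ht ↦ by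
    have := abs_le.1 (q t ht)
    rw [clampBox, min_eq_right (by linarith), max_eq_right (by linarith)]
    exact q t ht
  -- The term -2z is damping: the rest of the right-hand side is at most 5900, less than 2 · 3000.
  have z1 : ∀ t ∈ Set.Icc 0 T, X t 3 ≤ 3000 := by
    refine le_of_deriv_neg_at_level d3 h3.2 fun t ht h ↦ ?_
    have := abs_le.1 (abs_fourthOrderRHS_add_le (x := clampBox (X t) 0)
      (z := clampBox (X t) 3) (c1 t ht) (c2 t ht))
    have : 3000 ≤ clampBox (X t) 3 := le_max_of_le_right (le_min (by norm_num) h.ge)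
    linarith
  have z2 : ∀ t ∈ Set.Icc 0 T, -X t 3 ≤ 3000 := by
    refine le_of_deriv_neg_at_level (fun t ↦ (d3 t).neg) (by linarith) fun t ht h ↦ ?_
    have := abs_le.1 (abs_fourthOrderRHS_add_le (x := clampBox (X t) 0)
      (z := clampBox (X t) 3) (c1 t ht) (c2 t ht))
    have : clampBox (X t) 3 ≤ -3000 :=
      max_le (by norm_num) (min_le_of_right_le (by linarith))
    linarith
  have := hb t ht
  exact ⟨abs_le.2 ⟨by linarith, by linarith⟩, q t ht, this.2.2,
    abs_le.2 ⟨by linarith [z2 t ht], z1 t ht⟩⟩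
/-! ### One-sided sign lemmas -/

theorem deriv_nonneg_of_eventually_le_left {f : ℝ → ℝ} {f' T : ℝ} (hf : HasDerivAt f f' T)
    (h : ∀ᶠ t in 𝓝[<] T, f t ≤ f T) : 0 ≤ f' := by
  have hs := (hasDerivAt_iff_tendsto_slope.1 hf).mono_left
    (nhdsWithin_mono T fun t (ht : t ∈ Set.Iio T) ↦ ne_of_lt ht)
  refine ge_of_tendsto hs ?_
  filter_upwards [h, self_mem_nhdsWithin] with t ht htT
  rw [slope_def_field]
  exact div_nonneg_of_nonpos (sub_nonpos.2 ht) (sub_nonpos.2 (le_of_lt htT))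

theorem eventually_gt_right_of_deriv_pos {f : ℝ → ℝ} {f' T : ℝ} (hf : HasDerivAt f f' T)
    (h : 0 < f') : ∀ᶠ t in 𝓝[>] T, f T < f t := by
  have hs := (hasDerivAt_iff_tendsto_slope.1 hf).mono_left
    (nhdsWithin_mono T fun t (ht : t ∈ Set.Ioi T) ↦ ne_of_gt ht)
  filter_upwards [hs.eventually (lt_mem_nhds h), self_mem_nhdsWithin] with t ht htT
  rw [slope_def_field, div_pos_iff_of_pos_right (sub_pos.2 htT)] at ht
  linarith

/-- In either case f' is positive just after T, so f is strictly increasing there. This covers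
tangential contact with the boundary. -/
theorem eventually_gt_right_of_second_deriv {f f' : ℝ → ℝ} {f'' T : ℝ}
    (hf : ∀ᶠ t in 𝓝 T, HasDerivAt f (f' t) t) (hf' : HasDerivAt f' f'' T) (h1 : 0 ≤ f' T)
    (h2 : f' T = 0 → 0 < f'') : ∀ᶠ t in 𝓝[>] T, f T < f t := by
  have hpos : ∀ᶠ t in 𝓝[>] T, 0 < f' t := by
    rcases h1.eq_or_lt with h | h
    · simpa [← h] using eventually_gt_right_of_deriv_pos hf' (h2 h.symm)
    · exact (hf'.continuousAt.eventually (lt_mem_nhds h)).filter_mono nhdsWithin_le_nhds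
  obtain ⟨ε, hε, hball⟩ := Metric.eventually_nhds_iff.1 hf
  obtain ⟨u, hu, hIoo⟩ := mem_nhdsGT_iff_exists_Ioo_subset.1 hpos
  have hmem : Set.Ioo T (min u (T + ε)) ∈ 𝓝[>] T :=
    Ioo_mem_nhdsGT (lt_min hu (lt_add_of_pos_right T hε))
  filter_upwards [hmem] with t ht
  have htu := ht.2.trans_le (min_le_left _ _)
  have htε := ht.2.trans_le (min_le_right _ _)
  have hd : ∀ s ∈ Set.Icc T t, HasDerivAt f (f' s) s := fun s hs ↦ hball (by
    rw [Real.dist_eq, abs_of_nonneg (sub_nonneg.2 hs.1)]; linarith [hs.2])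
  refine strictMonoOn_of_deriv_pos (convex_Icc T t)
    (fun s hs ↦ (hd s hs).continuousAt.continuousWithinAt) (fun s hs ↦ ?_)
    (Set.left_mem_Icc.2 ht.1.le) (Set.right_mem_Icc.2 ht.1.le) ht.1
  rw [interior_Icc] at hs
  rw [(hd s ⟨hs.1.le, hs.2.le⟩).deriv]
  exact hIoo ⟨hs.1, hs.2.trans htu⟩

/-! ### The reflection symmetry -/

/-- The symmetry `φ ↦ π - φ` in phase space. -/
noncomputable def reflect (X : Fin 4 → ℝ) : Fin 4 → ℝ := ![Real.pi - X 0, -X 1, -X 2, -X 3]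

theorem phaseField_reflect (X : Fin 4 → ℝ) :
    phaseField (reflect X) = ![-X 1, -X 2, -X 3, -phaseField X 3] := by
  have e : 2 * (Real.pi - X 0) = 2 * Real.pi - 2 * X 0 := by ring
  ext i
  fin_cases i <;>
    simp [phaseField, reflect, fourthOrderRHS, e, Real.cos_two_pi_sub, Real.sin_two_pi_sub]
  ring

theorem HasDerivAt.reflect {X : ℝ → Fin 4 → ℝ} {t : ℝ} (h : HasDerivAt X (phaseField (X t)) t) :
    HasDerivAt (fun s ↦ reflect (X s)) (phaseField (_root_.reflect (X t))) t := by
  obtain ⟨h0, h1, h2, h3⟩ := hasDerivAt_coord h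
  rw [phaseField_reflect, hasDerivAt_pi]
  intro i
  fin_cases i
  · simpa [_root_.reflect] using h0.const_sub Real.pi
  · simpa [_root_.reflect] using h1.fun_neg
  · simpa [_root_.reflect] using h2.fun_neg
  · simpa [_root_.reflect, phaseField] using h3.fun_neg

theorem energy_reflect (X : Fin 4 → ℝ) : energy (reflect X) = energy X := by
  have e : 2 * (Real.pi - X 0) = 2 * Real.pi - 2 * X 0 := by ring
  simp [energy, reflect, e, Real.cos_two_pi_sub]
  ring

theorem reflect_mem_closedRegion {X : Fin 4 → ℝ} :
    reflect X ∈ closedRegion ↔ X ∈ closedRegion := by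
  simp only [closedRegion, reflect, Set.mem_ofPred_eq, Matrix.cons_val, sub_sub_cancel]
  constructor <;> rintro ⟨h1, h2, h3, h4⟩ <;> refine ⟨?_, ?_, ?_, ?_⟩ <;> linarith

/-! ### Exits from the region -/

/-- Points of the right and upper boundary through which orbits leave the region. -/
def ExitsUpward (X : Fin 4 → ℝ) : Prop :=
  0 < X 1 ∧ (X 0 = Real.pi ∨ (Real.pi / 2 ≤ X 0 ∧ X 0 < Real.pi ∧ X 2 = 2 * √6 ∧ 0 ≤ X 3) ∨
    (0 < X 0 ∧ X 0 < Real.pi / 2 ∧ X 2 = 2 * √6 * Real.sin (X 0) ∧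
      2 * √6 * (Real.cos (X 0) * X 1) ≤ X 3))

/-- In this form y²/2 - 12 sin² x stands apart. It is nonnegative on the upper boundary and vanishes
on its curved part. -/
theorem energy_gt_iff {X : Fin 4 → ℝ} : -6 < energy X ↔
    X 2 ^ 2 / 2 + (5 / 2 + 4 * Real.cos (X 0) ^ 2) * X 1 ^ 2 + 3 / 2 * X 1 ^ 4
      - 12 * Real.sin (X 0) ^ 2 < X 1 * (X 3 + 2 * X 2) := by
  have := Real.sin_sq_add_cos_sq (X 0)
  have e : energy X + 6 = X 1 * (X 3 + 2 * X 2) - (X 2 ^ 2 / 2 +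
      (5 / 2 + 4 * Real.cos (X 0) ^ 2) * X 1 ^ 2 + 3 / 2 * X 1 ^ 4
      - 12 * Real.sin (X 0) ^ 2) := by
    rw [energy, Real.cos_two_mul, Real.sin_sq]; ring
  constructor <;> intro h <;> linarith

/-- Arrival from inside gives a one-sided sign for the derivative of the defining function of the
boundary; the energy inequality then upgrades this to p > 0. -/
theorem exitsUpward_of_mem_boundary {X : ℝ → Fin 4 → ℝ} {T : ℝ}
    (hX : HasDerivAt X (phaseField (X T)) T) (hE : -6 < energy (X T))
    (hbefore : ∀ᶠ t in 𝓝[<] T, X t ∈ closedRegion)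
    (hT : X T 0 = Real.pi ∨
      (0 < X T 0 ∧ X T 0 < Real.pi ∧ X T 2 = boundaryF (X T 0))) : ExitsUpward (X T) := by
  obtain ⟨h0, h1, h2, h3⟩ := hasDerivAt_coord hX
  rw [energy_gt_iff] at hE
  have h6 : √6 ^ 2 = 6 := Real.sq_sqrt (by norm_num)
  have hsc := Real.sin_sq_add_cos_sq (X T 0)
  rcases hT with hT | ⟨hx0, hxpi, hy⟩
  · have hp : 0 ≤ X T 1 := deriv_nonneg_of_eventually_le_left h0 (by
      filter_upwards [hbefore] with t ht
      rw [hT]; exact ht.2.1)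
    refine ⟨hp.lt_of_ne fun h ↦ ?_, .inl hT⟩
    rw [← h, hT, Real.sin_pi] at hE
    nlinarith [sq_nonneg (X T 2)]
  rcases le_or_gt (Real.pi / 2) (X T 0) with hx | hx
  · rw [boundaryF_eq, min_eq_right hx, Real.sin_pi_div_two, mul_one] at hy
    have hz : 0 ≤ X T 3 := deriv_nonneg_of_eventually_le_left h2 (by
      filter_upwards [hbefore] with t ht
      rw [hy]; exact ht.2.2.2.trans (boundaryF_le _))
    refine ⟨?_, .inr (.inl ⟨hx, hxpi, hy, hz⟩)⟩
    have hpos : 0 < X T 1 * (X T 3 + 2 * X T 2) := by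
      refine lt_of_le_of_lt ?_ hE
      have : 0 ≤ (5 / 2 + 4 * Real.cos (X T 0) ^ 2) * X T 1 ^ 2 := by positivity
      have : 0 ≤ 3 / 2 * X T 1 ^ 4 := by positivity
      rw [hy]
      nlinarith [sq_nonneg (Real.cos (X T 0))]
    refine pos_of_mul_pos_left hpos ?_
    rw [hy]; positivity
  · rw [boundaryF_eq, min_eq_left hx.le] at hy
    have hs : 0 < Real.sin (X T 0) := Real.sin_pos_of_pos_of_lt_pi hx0 hxpi
    have hz := deriv_nonneg_of_eventually_le_left (h2.sub (h0.sin.const_mul (2 * √6))) (by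
      filter_upwards [hbefore, h0.continuousAt.continuousWithinAt.eventually (gt_mem_nhds hx)]
        with t ht htx
      have := ht.2.2.2
      rw [boundaryF_eq, min_eq_left htx.le] at this
      simp only [Pi.sub_apply]
      linarith)
    refine ⟨?_, .inr (.inr ⟨hx0, hx, hy, by linarith⟩)⟩
    have hy2 : X T 2 ^ 2 / 2 = 12 * Real.sin (X T 0) ^ 2 := by rw [hy, mul_pow, mul_pow, h6]; ring
    have hypos : 0 < X T 2 := by rw [hy]; positivity
    set p := X T 1
    set c := Real.cos (X T 0)
    by_contra! hp
    -- The expression is (2c - √6/2)² + 1. If p ≤ 0, then z ≥ 2√6 c p and y > 0 bound p(z + 2y) by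
    -- 2√6 c p², too small for the energy inequality.
    have hq : 0 < 5 / 2 + 4 * c ^ 2 - 2 * √6 * c := by nlinarith [sq_nonneg (2 * c - √6 / 2)]
    have h4 : 0 ≤ 3 / 2 * p ^ 4 := by positivity
    have h5 : p * (X T 3 + 2 * X T 2) ≤ p * (2 * √6 * (c * p)) :=
      mul_le_mul_of_nonpos_left (by linarith) hp
    have h7 : 0 ≤ (5 / 2 + 4 * c ^ 2 - 2 * √6 * c) * p ^ 2 := by positivity
    nlinarith

/-- At x = π the crossing is transversal. On the upper boundary the defining function has
nonnegative derivative, and when that vanishes the equation makes its second derivative positive. -/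
theorem eventually_notMem_of_exitsUpward {X : ℝ → Fin 4 → ℝ} {T : ℝ}
    (hX : ∀ᶠ t in 𝓝 T, HasDerivAt X (phaseField (X t)) t) (hT : ExitsUpward (X T)) :
    ∀ᶠ t in 𝓝[>] T, X t ∉ closedRegion := by
  obtain ⟨h0, h1, h2, h3⟩ := hasDerivAt_coord hX.self_of_nhds
  have h6 : √6 ^ 2 = 6 := Real.sq_sqrt (by norm_num)
  have h6' : 12 / 5 < √6 := Real.lt_sqrt_of_sq_lt (by norm_num)
  have hRHS : fourthOrderRHS (X T 0) (X T 1) (X T 2) (X T 3) =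
      (5 + 8 * Real.cos (X T 0) ^ 2) * X T 2 - 24 * (Real.sin (X T 0) * Real.cos (X T 0))
      + (6 * X T 2 - 8 * (Real.sin (X T 0) * Real.cos (X T 0))) * X T 1 ^ 2
      + (6 + 8 * Real.cos (X T 0) ^ 2) * X T 1 + 2 * X T 1 ^ 3 - 2 * X T 3 := by
    rw [fourthOrderRHS, Real.cos_two_mul, Real.sin_two_mul]; ring
  have hc1 := Real.cos_le_one (X T 0)
  obtain ⟨hp, hT | ⟨hx, hxpi, hy, hz⟩ | ⟨hx0, hx, hy, hz⟩⟩ := hT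
  · filter_upwards [eventually_gt_right_of_deriv_pos h0 hp] with t ht hmem
    exact absurd hmem.2.1 (by rw [← hT]; exact not_le.2 ht)
  · have hs : 0 ≤ Real.sin (X T 0) := Real.sin_nonneg_of_nonneg_of_le_pi
      (by linarith [Real.pi_pos]) hxpi.le
    have hc : Real.cos (X T 0) ≤ 0 :=
      Real.cos_nonpos_of_pi_div_two_le_of_le hx (by linarith [Real.pi_pos])
    have hsc : 0 ≤ -(Real.sin (X T 0) * Real.cos (X T 0)) := by nlinarith
    have key := eventually_gt_right_of_second_deriv
      (hX.mono fun t ht ↦ (hasDerivAt_coord ht).2.2.1) h3 hz (fun hz0 ↦ by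
        rw [hRHS, hz0, hy]
        have i2 : 0 < (5 + 8 * Real.cos (X T 0) ^ 2) * (2 * √6) := by positivity
        have i3 : 0 ≤ (6 * (2 * √6) - 8 * (Real.sin (X T 0) * Real.cos (X T 0))) * X T 1 ^ 2 :=
          mul_nonneg (by linarith) (sq_nonneg _)
        have i4 : 0 < (6 + 8 * Real.cos (X T 0) ^ 2) * X T 1 := by positivity
        have i5 : 0 < 2 * X T 1 ^ 3 := by positivity
        linarith)
    filter_upwards [key] with t ht hmem
    have := hmem.2.2.2.trans (boundaryF_le _)
    linarith
  · have hs : 0 < Real.sin (X T 0) :=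
      Real.sin_pos_of_pos_of_lt_pi hx0 (by linarith [Real.pi_pos])
    have key := eventually_gt_right_of_second_deriv
      (f := fun t ↦ X t 2 - 2 * √6 * Real.sin (X t 0))
      (f' := fun t ↦ X t 3 - 2 * √6 * (Real.cos (X t 0) * X t 1))
      (hX.mono fun t ht ↦
        (hasDerivAt_coord ht).2.2.1.sub ((hasDerivAt_coord ht).1.sin.const_mul (2 * √6)))
      (h3.sub ((h0.cos.mul h1).const_mul (2 * √6))) (by linarith) (fun hz0 ↦ by
        have hz' : X T 3 = 2 * √6 * (Real.cos (X T 0) * X T 1) := by linarith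
        rw [hRHS, hz', hy]
        set s := Real.sin (X T 0)
        set c := Real.cos (X T 0)
        set p := X T 1
        -- `i1`, `i2`, `i3` are the coefficients of s, s p² and p in the second derivative of y -
        -- 2√6 sin x; the remaining term is 2p³.
        have i1 : 0 < 2 * √6 * (5 + 8 * c ^ 2) - 48 * c := by
          nlinarith [mul_lt_mul_of_pos_right h6' (by positivity : 0 < 5 + 8 * c ^ 2),
            sq_nonneg (c - 5 / 8)]
        have i2 : 0 < 14 * √6 - 8 * c := by linarith
        have i3 : 0 < 6 + 8 * c ^ 2 - 4 * √6 * c := by nlinarith [sq_nonneg (c - √6 / 4)]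
        have := mul_pos hs i1
        have := mul_pos (mul_pos hs (pow_pos hp 2)) i2
        have := mul_pos hp i3
        have := pow_pos hp 3
        have : 2 * √6 * (c * (2 * √6 * s)) = 24 * (s * c) := by linear_combination 4 * c * s * h6
        linarith)
    filter_upwards [key, (h0.continuousAt.eventually (gt_mem_nhds hx)).filter_mono
      nhdsWithin_le_nhds] with t ht htx hmem
    have := hmem.2.2.2
    rw [boundaryF_eq, min_eq_left htx.le] at this
    simp only [hy, sub_self] at ht
    linarith

theorem exits_of_notMem_openRegion {X : ℝ → Fin 4 → ℝ} {T : ℝ}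
    (hX : HasDerivAt X (phaseField (X T)) T) (hE : -6 < energy (X T))
    (hbefore : ∀ᶠ t in 𝓝[<] T, X t ∈ closedRegion) (hmem : X T ∈ closedRegion)
    (hnot : X T ∉ openRegion) : ExitsUpward (X T) ∨ ExitsUpward (reflect (X T)) := by
  obtain ⟨h0, hpi, hlo, hhi⟩ := hmem
  have hup := exitsUpward_of_mem_boundary hX hE hbefore
  have hdown := exitsUpward_of_mem_boundary (X := fun t ↦ reflect (X t)) hX.reflect
    (by rwa [energy_reflect]) (by simpa only [reflect_mem_closedRegion] using hbefore)
  simp only [reflect, Matrix.cons_val] at hdown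
  rcases h0.eq_or_lt with h0 | h0
  · exact .inr (hdown (.inl (by linarith)))
  rcases hpi.eq_or_lt with hpi | hpi
  · exact .inl (hup (.inl hpi))
  rcases hhi.eq_or_lt with hhi | hhi
  · exact .inl (hup (.inr ⟨h0, hpi, hhi⟩))
  rcases hlo.eq_or_lt with hlo | hlo
  · exact .inr (hdown (.inr ⟨by linarith, by linarith, by linarith⟩))
  · exact absurd ⟨h0, hpi, hlo, hhi⟩ hnot

theorem eventually_notMem_of_exits {X : ℝ → Fin 4 → ℝ} {T : ℝ}
    (hX : ∀ᶠ t in 𝓝 T, HasDerivAt X (phaseField (X t)) t)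
    (hT : ExitsUpward (X T) ∨ ExitsUpward (reflect (X T))) :
    ∀ᶠ t in 𝓝[>] T, X t ∉ closedRegion := by
  rcases hT with hT | hT
  · exact eventually_notMem_of_exitsUpward hX hT
  · simpa only [reflect_mem_closedRegion] using
      eventually_notMem_of_exitsUpward (X := fun t ↦ reflect (X t)) (hX.mono fun t ht ↦ ht.reflect) hT

/-- An orbit above the energy level of the origin cannot touch the boundary from inside. -/
theorem mem_openRegion_of_eventually {X : ℝ → Fin 4 → ℝ} {T : ℝ}
    (hX : ∀ᶠ t in 𝓝 T, HasDerivAt X (phaseField (X t)) t) (hE : -6 < energy (X T))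
    (h : ∀ᶠ t in 𝓝 T, X t ∈ closedRegion) : X T ∈ openRegion := by
  by_contra hnot
  have := eventually_notMem_of_exits hX (exits_of_notMem_openRegion hX.self_of_nhds hE
    (h.filter_mono nhdsWithin_le_nhds) h.self_of_nhds hnot)
  obtain ⟨t, ht1, ht2⟩ := (this.and (h.filter_mono nhdsWithin_le_nhds)).exists
  exact ht1 ht2
/-! ### Shooting -/

/-- Lower semicontinuity: a compact piece of orbit inside the open set U stays inside under
perturbation. Upper semicontinuity: just after exit the orbit is in the open complement of D, and so
are nearby orbits. -/
theorem continuous_exitTime {α E : Type*} [TopologicalSpace α] [TopologicalSpace E]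
    {u : α → ℝ → E} (hu : Continuous fun q : α × ℝ ↦ u q.1 q.2) {U D : Set E} (hU : IsOpen U)
    (hD : IsClosed D) (hUD : U ⊆ D) {T : α → ℝ} (hT0 : ∀ a, 0 ≤ T a)
    (hTnot : ∀ a, u a (T a) ∉ U) (hTmem : ∀ a, ∀ t ∈ Set.Ico 0 (T a), u a t ∈ U)
    (hout : ∀ a, ∀ᶠ t in 𝓝[>] T a, u a t ∉ D) : Continuous T := by
  rw [continuous_iff_continuousAt]
  intro a
  refine tendsto_order.2 ⟨fun c hc ↦ ?_, fun c hc ↦ ?_⟩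
  · have : ∀ᶠ b in 𝓝 a, ∀ t ∈ Set.Icc 0 c, u b t ∈ U :=
      isCompact_Icc.eventually_forall_of_forall_eventually fun t ht ↦
        hu.continuousAt.eventually (hU.mem_nhds (hTmem a t ⟨ht.1, ht.2.trans_lt hc⟩))
    filter_upwards [this] with b hb
    by_contra! h
    exact hTnot b (hb _ ⟨hT0 b, h⟩)
  · obtain ⟨t, ht, htmem⟩ := ((hout a).and (Ioo_mem_nhdsGT hc)).exists
    have hcont : Continuous fun b ↦ u b t := hu.comp (by fun_prop : Continuous fun b ↦ (b, t))
    filter_upwards [hcont.continuousAt.eventually (hD.isOpen_compl.mem_nhds ht)] with b hb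
    refine lt_of_not_ge fun h ↦ hb (hUD (hTmem b t ⟨(hT0 a).trans htmem.1.le, ?_⟩))
    exact htmem.2.trans_le h

theorem energy_monotoneOn {X : ℝ → Fin 4 → ℝ} {s : Set ℝ} (hs : Convex ℝ s)
    (hX : ∀ t ∈ s, HasDerivAt X (phaseField (X t)) t) :
    MonotoneOn (fun t ↦ energy (X t)) s := by
  refine monotoneOn_of_deriv_nonneg hs
    (fun t ht ↦ (hasDerivAt_energy (hX t ht)).continuousAt.continuousWithinAt)
    (fun t ht ↦ (hasDerivAt_energy
      (hX t (interior_subset ht))).differentiableAt.differentiableWithinAt) fun t ht ↦ ?_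
  rw [(hasDerivAt_energy (hX t (interior_subset ht))).deriv]
  exact dissipation_nonneg _

/-- A small arc of initial data joining the left boundary of the region to the upper one. -/
noncomputable def arc (d τ : ℝ) : Fin 4 → ℝ :=
  ![d * (1 + τ) / 2, d * τ, 2 * √6 * Real.sin (d * (1 + τ) / 2) * max τ 0, 8 * (d * τ)]

theorem continuous_arc (d : ℝ) : Continuous (arc d) := by
  rw [continuous_pi_iff]
  intro i
  fin_cases i <;> simp [arc] <;> fun_prop

section Arc

variable {d τ : ℝ}

theorem arc_bounds (hd : 0 < d) (hd1 : d ≤ 1 / 2) (hτ : τ ∈ Set.Icc (-1 : ℝ) 1) :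
    0 ≤ d * (1 + τ) / 2 ∧ d * (1 + τ) / 2 ≤ d ∧ d * (1 + τ) / 2 < Real.pi / 2 ∧
    0 ≤ Real.sin (d * (1 + τ) / 2) ∧ 0 ≤ max τ 0 ∧ max τ 0 ≤ 1 := by
  have h3 := Real.pi_gt_three
  have h0 : 0 ≤ d * (1 + τ) / 2 := by have := hτ.1; have : 0 ≤ 1 + τ := by linarith
                                      positivity
  have h1 : d * (1 + τ) / 2 ≤ d := by nlinarith [hτ.2]
  exact ⟨h0, h1, by linarith, Real.sin_nonneg_of_nonneg_of_le_pi h0 (by linarith),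
    le_max_right _ _, max_le hτ.2 zero_le_one⟩

/-- The factor 8 in the last coordinate of `arc` is 5/2 + 4 + 3/2, so for 0 < |p| < 1 the term pz =
8p² beats all powers of p on the other side. At τ = 0 both p and y vanish, and -12 sin² x < 0
suffices. -/
theorem energy_arc (hd : 0 < d) (hd1 : d ≤ 1 / 2) (hτ : τ ∈ Set.Icc (-1 : ℝ) 1) :
    -6 < energy (arc d τ) := by
  obtain ⟨h0, h1, h2, hs, hm, hm1⟩ := arc_bounds hd hd1 hτ
  rw [energy_gt_iff]
  simp only [arc, Matrix.cons_val]
  have h6 : √6 ^ 2 = 6 := Real.sq_sqrt (by norm_num)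
  have hc := Real.sin_sq_add_cos_sq (d * (1 + τ) / 2)
  set s := Real.sin (d * (1 + τ) / 2)
  set c := Real.cos (d * (1 + τ) / 2)
  have e : (2 * √6 * s * max τ 0) ^ 2 / 2 = 12 * s ^ 2 * (max τ 0) ^ 2 := by
    linear_combination 2 * s ^ 2 * (max τ 0) ^ 2 * h6
  have hcross : 0 ≤ d * τ * (2 * √6 * s * max τ 0) := by
    have : 0 ≤ τ * max τ 0 := by
      rcases le_total τ 0 with h | h
      · simp [h]
      · positivity
    have e : d * τ * (2 * √6 * s * max τ 0) = 2 * √6 * d * s * (τ * max τ 0) := by ring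
    rw [e]; positivity
  rw [e]
  have hp1 : (d * τ) ^ 2 < 1 := by
    rw [sq_lt_one_iff_abs_lt_one, abs_mul, abs_of_pos hd]
    exact (mul_le_of_le_one_right hd.le (abs_le.2 hτ)).trans_lt (by linarith)
  have hm2 : (max τ 0) ^ 2 ≤ 1 := pow_le_one₀ hm hm1
  have hc2 : c ^ 2 * (d * τ) ^ 2 ≤ (d * τ) ^ 2 := by
    nlinarith [sq_nonneg (d * τ), sq_nonneg s]
  have hs2 : s ^ 2 * (max τ 0) ^ 2 ≤ s ^ 2 := by nlinarith [sq_nonneg s]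
  rcases eq_or_ne τ 0 with rfl | hτ0
  · have : 0 < s := Real.sin_pos_of_pos_of_lt_pi (by simp [hd]) (by linarith [Real.pi_pos])
    simp
    positivity
  · have hp : 0 < (d * τ) ^ 2 := by positivity
    have h4 : (d * τ) ^ 4 < (d * τ) ^ 2 := by nlinarith
    nlinarith

theorem arc_mem_closedRegion (hd : 0 < d) (hd1 : d ≤ 1 / 2) (hτ : τ ∈ Set.Icc (-1 : ℝ) 1) :
    arc d τ ∈ closedRegion := by
  obtain ⟨h0, h1, h2, hs, hm, hm1⟩ := arc_bounds hd hd1 hτ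
  simp only [closedRegion, arc, Set.mem_ofPred_eq, Matrix.cons_val, boundaryF_eq]
  rw [min_eq_left h2.le, min_eq_right (by linarith), Real.sin_pi_div_two]
  refine ⟨h0, by linarith [Real.pi_pos], ?_, mul_le_of_le_one_right (by positivity) hm1⟩
  have : 0 ≤ 2 * √6 * Real.sin (d * (1 + τ) / 2) * max τ 0 := by positivity
  have : 0 ≤ √6 := by positivity
  linarith

theorem arc_mem_openRegion (hd : 0 < d) (hd1 : d ≤ 1 / 2) (hτ : τ ∈ Set.Ioo (-1 : ℝ) 1) :
    arc d τ ∈ openRegion := by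
  obtain ⟨h0, h1, h2, hs, hm, hm1⟩ := arc_bounds hd hd1 (Set.Ioo_subset_Icc_self hτ)
  simp only [openRegion, regionC, arc, Set.mem_ofPred_eq, Matrix.cons_val, boundaryF_eq]
  rw [min_eq_left h2.le, min_eq_right (by linarith), Real.sin_pi_div_two]
  have hx : 0 < d * (1 + τ) / 2 := by have := hτ.1; have : 0 < 1 + τ := by linarith
                                      positivity
  have hs : 0 < Real.sin (d * (1 + τ) / 2) :=
    Real.sin_pos_of_pos_of_lt_pi hx (by linarith [Real.pi_pos])
  refine ⟨hx, by linarith [Real.pi_pos], ?_,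
    mul_lt_of_lt_one_right (by positivity) (max_lt hτ.2 one_pos)⟩
  have : 0 ≤ 2 * √6 * Real.sin (d * (1 + τ) / 2) * max τ 0 := by positivity
  have : 0 < √6 := by positivity
  linarith

theorem exitsUpward_arc_one (hd : 0 < d) (hd1 : d ≤ 1 / 2) : ExitsUpward (arc d 1) := by
  have h3 := Real.pi_gt_three
  have h5 := two_sqrt_six_lt
  have e : d * (1 + 1) / 2 = d := by ring
  refine ⟨by simpa [arc] using hd, .inr (.inr ?_)⟩
  simp only [arc, Matrix.cons_val, e]
  refine ⟨hd, by linarith, by simp, ?_⟩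
  have : Real.cos d * (d * 1) ≤ 1 * (d * 1) :=
    mul_le_mul_of_nonneg_right (Real.cos_le_one d) (by linarith)
  calc 2 * √6 * (Real.cos d * (d * 1)) ≤ 2 * √6 * (1 * (d * 1)) := by gcongr
    _ ≤ 8 * (d * 1) := by nlinarith

theorem exitsUpward_reflect_arc_neg_one (hd : 0 < d) : ExitsUpward (reflect (arc d (-1))) :=
  ⟨by simpa [arc, reflect] using hd, .inl (by simp [arc, reflect])⟩

theorem norm_arc_le (hd : 0 < d) (hd1 : d ≤ 1 / 2) (hτ : τ ∈ Set.Icc (-1 : ℝ) 1) :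
    ‖arc d τ‖ ≤ 8 * d := by
  obtain ⟨h0, h1, h2, hs, hm, hm1⟩ := arc_bounds hd hd1 hτ
  have hτ' : |d * τ| ≤ d := by
    rw [abs_mul, abs_of_pos hd]; exact mul_le_of_le_one_right hd.le (abs_le.2 hτ)
  rw [pi_norm_le_iff_of_nonneg (by positivity)]
  intro i
  rw [Real.norm_eq_abs]
  fin_cases i <;> simp only [arc, Fin.zero_eta, Fin.mk_one, Fin.reduceFinMk, Matrix.cons_val]
  · rw [abs_of_nonneg h0]; linarith
  · linarith
  · rw [abs_of_nonneg (by positivity)]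
    have h5 := two_sqrt_six_lt
    calc 2 * √6 * Real.sin (d * (1 + τ) / 2) * max τ 0 ≤ 5 * d * 1 := by
          gcongr
          exact (Real.sin_le h0).trans h1
      _ ≤ 8 * d := by linarith
  · rw [abs_mul, abs_of_pos (by norm_num : (0 : ℝ) < 8)]; linarith

end Arc

section Orbit

variable {Φ : (Fin 4 → ℝ) → ℝ → Fin 4 → ℝ} {K : NNReal}

theorem IsGlobalFlow.hasDerivAt_phaseField (hΦ : IsGlobalFlow truncField Φ) {x : Fin 4 → ℝ} {t : ℝ}
    (h : Φ x t ∈ innerBox) : ∀ᶠ s in 𝓝 t, HasDerivAt (Φ x) (phaseField (Φ x s)) s := by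
  filter_upwards [(hΦ.continuous x).continuousAt.eventually
    (truncField_eventuallyEq_of_mem_innerBox h)] with s hs
  exact hs ▸ hΦ.hasDerivAt x s

theorem IsGlobalFlow.arc_mem_innerBox (hΦ : IsGlobalFlow truncField Φ) {d τ T : ℝ} (hd : 0 < d)
    (hd1 : d ≤ 1 / 2) (hτ : τ ∈ Set.Icc (-1 : ℝ) 1)
    (h : ∀ t ∈ Set.Icc 0 T, Φ (arc d τ) t ∈ closedRegion) :
    ∀ t ∈ Set.Icc 0 T, Φ (arc d τ) t ∈ innerBox := by
  have hb : |d * τ| ≤ 1 := by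
    rw [abs_mul, abs_of_pos hd]
    exact (mul_le_of_le_one_right hd.le (abs_le.2 hτ)).trans (by linarith)
  refine mem_innerBox_of_mem_closedRegion (fun t ↦ hΦ.hasDerivAt _ t) ?_ ?_ h
  · rw [hΦ.zero]
    simpa only [arc, Matrix.cons_val] using hb
  · rw [hΦ.zero]
    simp only [arc, Matrix.cons_val]
    rw [abs_mul, abs_of_pos (by norm_num : (0 : ℝ) < 8)]
    linarith

/-- Some orbit starting on the arc never leaves the region. -/
theorem exists_forall_mem_openRegion (hΦ : IsGlobalFlow truncField Φ)
    (hK : LipschitzWith K truncField) {d : ℝ} (hd : 0 < d) (hd1 : d ≤ 1 / 2) :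
    ∃ τ ∈ Set.Icc (-1 : ℝ) 1, ∀ t, 0 ≤ t → Φ (arc d τ) t ∈ openRegion := by
  by_contra! hcon
  let u : Set.Icc (-1 : ℝ) 1 → ℝ → Fin 4 → ℝ := fun τ t ↦ Φ (arc d τ) t
  have hu : Continuous fun q : Set.Icc (-1 : ℝ) 1 × ℝ ↦ u q.1 q.2 :=
    (hΦ.continuous_uncurry hK).comp
      (((continuous_arc d).comp (continuous_subtype_val.comp continuous_fst)).prodMk continuous_snd)
  have hu0 : ∀ τ, u τ 0 = arc d τ := fun τ ↦ hΦ.zero _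
  have huc : ∀ τ, Continuous (u τ) := fun τ ↦ hΦ.continuous _
  let bad : Set.Icc (-1 : ℝ) 1 → Set ℝ := fun τ ↦ {t | 0 ≤ t ∧ u τ t ∉ openRegion}
  have hbad : ∀ τ, IsClosed (bad τ) := fun τ ↦
    isClosed_Ici.inter (isOpen_openRegion.preimage (huc τ)).isClosed_compl
  have hbdd : ∀ τ, BddBelow (bad τ) := fun τ ↦ ⟨0, fun t ht ↦ ht.1⟩
  let T : Set.Icc (-1 : ℝ) 1 → ℝ := fun τ ↦ sInf (bad τ)
  have hTbad : ∀ τ, T τ ∈ bad τ := fun τ ↦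
    (hbad τ).csInf_mem (hcon τ τ.2) (hbdd τ)
  have hTmem : ∀ τ, ∀ t ∈ Set.Ico 0 (T τ), u τ t ∈ openRegion := fun τ t ht ↦ by
    by_contra h
    exact (csInf_le (hbdd τ) ⟨ht.1, h⟩).not_gt ht.2
  have hclosed : ∀ τ, ∀ t ∈ Set.Icc 0 (T τ), u τ t ∈ closedRegion := fun τ t ht ↦ by
    rcases ht.2.lt_or_eq with h | h
    · exact openRegion_subset (hTmem τ t ⟨ht.1, h⟩)
    rcases ht.1.eq_or_lt with h0 | h0
    · rw [← h0, hu0]; exact arc_mem_closedRegion hd hd1 τ.2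
    · refine isClosed_closedRegion.mem_of_tendsto
        ((huc τ).continuousAt.continuousWithinAt : Tendsto (u τ) (𝓝[<] t) _) ?_
      filter_upwards [Ioo_mem_nhdsLT h0] with s hs
      exact openRegion_subset (hTmem τ s ⟨hs.1.le, h ▸ hs.2⟩)
  have hbox : ∀ τ, ∀ t ∈ Set.Icc 0 (T τ), u τ t ∈ innerBox := fun τ ↦
    hΦ.arc_mem_innerBox hd hd1 τ.2 (hclosed τ)
  have hsol : ∀ τ, ∀ t ∈ Set.Icc 0 (T τ),
      ∀ᶠ s in 𝓝 t, HasDerivAt (u τ) (phaseField (u τ s)) s :=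
    fun τ t ht ↦ hΦ.hasDerivAt_phaseField (hbox τ t ht)
  have hE : ∀ τ, -6 < energy (u τ (T τ)) := fun τ ↦ by
    have h0 : (0 : ℝ) ∈ Set.Icc 0 (T τ) := ⟨le_rfl, (hTbad τ).1⟩
    have := energy_monotoneOn (convex_Icc 0 (T τ)) (fun t ht ↦ (hsol τ t ht).self_of_nhds)
      h0 ⟨(hTbad τ).1, le_rfl⟩ (hTbad τ).1
    simp only [hu0] at this
    exact (energy_arc hd hd1 τ.2).trans_le this
  have hexit : ∀ τ, ExitsUpward (u τ (T τ)) ∨ ExitsUpward (reflect (u τ (T τ))) := fun τ ↦ by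
    have hmem : T τ ∈ Set.Icc 0 (T τ) := ⟨(hTbad τ).1, le_rfl⟩
    rcases (hTbad τ).1.eq_or_lt with h0 | h0
    · have hnot := (hTbad τ).2
      rw [← h0, hu0] at hnot ⊢
      rcases τ.2.1.eq_or_lt with h | h
      · rw [← h]; exact .inr (exitsUpward_reflect_arc_neg_one hd)
      rcases τ.2.2.eq_or_lt with h' | h'
      · rw [h']; exact .inl (exitsUpward_arc_one hd hd1)
      · exact absurd (arc_mem_openRegion hd hd1 ⟨h, h'⟩) hnot
    · refine exits_of_notMem_openRegion (hsol τ _ hmem).self_of_nhds (hE τ) ?_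
        (hclosed τ _ hmem) (hTbad τ).2
      filter_upwards [Ioo_mem_nhdsLT h0] with s hs
      exact hclosed τ s ⟨hs.1.le, hs.2.le⟩
  have hTcont : Continuous T := continuous_exitTime hu isOpen_openRegion isClosed_closedRegion
    openRegion_subset (fun τ ↦ (hTbad τ).1) (fun τ ↦ (hTbad τ).2) hTmem fun τ ↦
      eventually_notMem_of_exits (hsol τ _ ⟨(hTbad τ).1, le_rfl⟩) (hexit τ)
  -- The velocity at exit: continuous, never zero by `hexit`, yet of opposite signs at the ends of
  -- the arc.
  have hg : Continuous fun τ ↦ u τ (T τ) 1 :=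
    (continuous_apply 1).comp (hu.comp (continuous_id.prodMk hTcont))
  have hT0 : ∀ τ : Set.Icc (-1 : ℝ) 1, arc d τ ∉ openRegion → T τ = 0 := fun τ h ↦
    le_antisymm (csInf_le (hbdd τ) ⟨le_rfl, by rwa [hu0]⟩) (hTbad τ).1
  have hm1 : u ⟨-1, by norm_num⟩ (T ⟨-1, by norm_num⟩) 1 ≤ 0 := by
    rw [hT0 ⟨-1, by norm_num⟩ (fun h ↦ by simpa [arc] using h.1), hu0]
    simpa [arc] using hd.le
  have hp1 : 0 ≤ u ⟨1, by norm_num⟩ (T ⟨1, by norm_num⟩) 1 := by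
    rw [hT0 ⟨1, by norm_num⟩ (fun h ↦ ?_), hu0]
    · simpa [arc] using hd.le
    · have h4 := h.2.2.2
      have h2 : d ≤ Real.pi / 2 := by linarith [Real.pi_gt_three]
      have e : d * (1 + 1) / 2 = d := by ring
      simp [arc, boundaryF_eq, e, h2] at h4
  have : PreconnectedSpace (Set.Icc (-1 : ℝ) 1) :=
    isPreconnected_iff_preconnectedSpace.1 isPreconnected_Icc
  obtain ⟨τ, hτ⟩ := mem_range_of_exists_le_of_exists_ge hg ⟨_, hm1⟩ ⟨_, hp1⟩
  rcases hexit τ with h | h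
  · exact h.1.ne' hτ
  · have := h.1
    simp [reflect] at this
    exact this.ne hτ

end Orbit
/-! ### Convergence to equilibria -/

theorem eventually_eq_zero_of_hasDerivAt {f f' : ℝ → ℝ} {t c : ℝ}
    (hf : ∀ᶠ s in 𝓝 t, HasDerivAt f (f' s) s) (hc : ∀ᶠ s in 𝓝 t, f s = c) :
    ∀ᶠ s in 𝓝 t, f' s = 0 := by
  filter_upwards [hf, hc.eventually_nhds] with s hs hcs
  exact hs.unique ((hasDerivAt_const s c).congr_of_eventuallyEq hcs)

theorem equilibrium_of_energy_eq {X : ℝ → Fin 4 → ℝ} {t e : ℝ}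
    (hX : ∀ᶠ s in 𝓝 t, HasDerivAt X (phaseField (X s)) s) (he : ∀ᶠ s in 𝓝 t, energy (X s) = e) :
    X t 1 = 0 ∧ X t 2 = 0 ∧ X t 3 = 0 ∧ Real.sin (2 * X t 0) = 0 := by
  have h12 : ∀ᶠ s in 𝓝 t, X s 1 = 0 ∧ X s 2 = 0 :=
    (eventually_eq_zero_of_hasDerivAt (hX.mono fun s hs ↦ hasDerivAt_energy hs) he).mono
      fun s hs ↦ eq_zero_of_dissipation_eq_zero hs
  have h3 : ∀ᶠ s in 𝓝 t, X s 3 = 0 := eventually_eq_zero_of_hasDerivAt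
    (hX.mono fun s hs ↦ (hasDerivAt_coord hs).2.2.1) (h12.mono fun s hs ↦ hs.2)
  have h4 := (eventually_eq_zero_of_hasDerivAt
    (hX.mono fun s hs ↦ (hasDerivAt_coord hs).2.2.2) h3).self_of_nhds
  obtain ⟨h1, h2⟩ := h12.self_of_nhds
  have h3 := h3.self_of_nhds
  refine ⟨h1, h2, h3, ?_⟩
  rw [h1, h2, h3, fourthOrderRHS] at h4
  linarith

theorem MapClusterPt.mem_of_eventually {α E : Type*} [TopologicalSpace E] {l : Filter α}
    {u : α → E} {W : E} {s : Set E} (h : MapClusterPt W l u) (hs : IsClosed s)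
    (hu : ∀ᶠ a in l, u a ∈ s) : W ∈ s := by
  by_contra hW
  obtain ⟨a, ha, ha'⟩ := ((h.frequently (hs.isOpen_compl.mem_nhds hW)).and_eventually hu).exists
  exact ha ha'

theorem MapClusterPt.eq_of_tendsto {α E : Type*} [TopologicalSpace E] [T2Space E] {l : Filter α}
    {u : α → E} {W y : E} (h : MapClusterPt W l u) (hu : Tendsto u l (𝓝 y)) : W = y := by
  have : NeBot (𝓝 W ⊓ 𝓝 y) := NeBot.mono h (inf_le_inf_left _ hu)
  exact eq_of_nhds_neBot this

theorem eq_vec_of_coords {W : Fin 4 → ℝ} {a : ℝ} (h0 : W 0 = a) (h1 : W 1 = 0) (h2 : W 2 = 0)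
    (h3 : W 3 = 0) : W = ![a, 0, 0, 0] := by
  ext i; fin_cases i <;> simp [h0, h1, h2, h3]

theorem truncField_zero : truncField 0 = 0 := by
  rw [truncField_eq (by simp)]
  ext i; fin_cases i <;> simp [phaseField, fourthOrderRHS]

section Limits

variable {Φ : (Fin 4 → ℝ) → ℝ → Fin 4 → ℝ} {K : NNReal}

theorem IsGlobalFlow.apply_zero_left (hΦ : IsGlobalFlow truncField Φ)
    (hK : LipschitzWith K truncField) (t : ℝ) : Φ 0 t = 0 := by
  have := hΦ.eq_of_hasDerivAt hK (y := fun _ ↦ 0) (fun t ↦ by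
    simpa [truncField_zero] using hasDerivAt_const t (0 : Fin 4 → ℝ))
  exact (congrFun this t).symm

/-- LaSalle's principle: the orbit through a cluster point consists of cluster points, so the energy
is constant on it. A filter invariant under translations treats both ends of time together. -/
theorem equilibrium_of_mapClusterPt (hΦ : IsGlobalFlow truncField Φ)
    (hK : LipschitzWith K truncField) {l : Filter ℝ} (hl : ∀ s, Tendsto (fun t ↦ t + s) l l)
    {x W : Fin 4 → ℝ} {e : ℝ} (hbox : ∀ᶠ t in l, Φ x t ∈ innerBox)
    (he : Tendsto (fun t ↦ energy (Φ x t)) l (𝓝 e)) (hW : MapClusterPt W l (Φ x)) :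
    W 1 = 0 ∧ W 2 = 0 ∧ W 3 = 0 ∧ Real.sin (2 * W 0) = 0 ∧ -6 * Real.cos (2 * W 0) = e := by
  have hcl : ∀ s, MapClusterPt (Φ W s) l (fun t ↦ Φ x (t + s)) := fun s ↦ by
    simpa only [Function.comp_def, ← hΦ.add hK] using
      hW.continuousAt_comp (hΦ.continuous_left hK s).continuousAt
  have hWbox : ∀ s, Φ W s ∈ innerBox := fun s ↦
    (hcl s).mem_of_eventually isCompact_innerBox.isClosed ((hl s).eventually hbox)
  have hWe : ∀ s, energy (Φ W s) = e := fun s ↦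
    ((hcl s).continuousAt_comp continuous_energy.continuousAt).eq_of_tendsto (he.comp (hl s))
  have h := equilibrium_of_energy_eq (hΦ.hasDerivAt_phaseField (hWbox 0)) (.of_forall hWe)
  have h0 := hWe 0
  rw [hΦ.zero] at h h0
  obtain ⟨h1, h2, h3, h4⟩ := h
  refine ⟨h1, h2, h3, h4, ?_⟩
  rw [← h0, energy, h1, h2, h3]
  ring

theorem tendsto_atTop_of_mem_closedRegion (hΦ : IsGlobalFlow truncField Φ)
    (hK : LipschitzWith K truncField) {x : Fin 4 → ℝ} (hE : -6 < energy x)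
    (hC : ∀ t, 0 ≤ t → Φ x t ∈ closedRegion) (hbox : ∀ t, 0 ≤ t → Φ x t ∈ innerBox) :
    Tendsto (Φ x) atTop (𝓝 ![Real.pi / 2, 0, 0, 0]) := by
  have hmono : MonotoneOn (fun t ↦ energy (Φ x t)) (Set.Ici 0) :=
    energy_monotoneOn (convex_Ici 0) fun t ht ↦
      (hΦ.hasDerivAt_phaseField (hbox t ht)).self_of_nhds
  have hmono' : Monotone fun t ↦ energy (Φ x (max t 0)) := fun s t hst ↦
    hmono (le_max_right s 0) (le_max_right t 0) (max_le_max_right 0 hst)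
  obtain ⟨B, hB⟩ := isCompact_innerBox.bddAbove_image continuous_energy.continuousOn
  have hlim := tendsto_atTop_ciSup hmono' ⟨B, by
    rintro _ ⟨t, rfl⟩
    exact hB ⟨_, hbox _ (le_max_right _ _), rfl⟩⟩
  set e := ⨆ t, energy (Φ x (max t 0))
  have he6 : -6 < e := hE.trans_le (by simpa [hΦ.zero] using hmono'.ge_of_tendsto hlim 0)
  have hlim' : Tendsto (fun t ↦ energy (Φ x t)) atTop (𝓝 e) := hlim.congr' (by
    filter_upwards [eventually_ge_atTop 0] with t ht
    rw [max_eq_left ht])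
  have hbox' : ∀ᶠ t in atTop, Φ x t ∈ innerBox := (eventually_ge_atTop 0).mono hbox
  refine isCompact_innerBox.le_nhds_of_unique_clusterPt hbox' fun W _ hW ↦ ?_
  have hWC : W ∈ closedRegion := MapClusterPt.mem_of_eventually hW isClosed_closedRegion
    ((eventually_ge_atTop 0).mono hC)
  obtain ⟨h1, h2, h3, h4, h5⟩ := equilibrium_of_mapClusterPt hΦ hK
    (fun s ↦ tendsto_atTop_add_const_right _ s tendsto_id) hbox' hlim' hW
  refine eq_vec_of_coords (Real.injOn_cos ⟨hWC.1, hWC.2.1⟩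
    ⟨by positivity, by linarith [Real.pi_pos]⟩ ?_) h1 h2 h3
  rw [Real.cos_pi_div_two]
  rw [Real.sin_two_mul, mul_assoc, mul_eq_zero, mul_eq_zero] at h4
  -- sin x = 0 would give energy -6, below the limit e.
  rcases h4 with h4 | h4 | h4
  · norm_num at h4
  · rw [Real.cos_two_mul, Real.cos_sq', h4] at h5
    linarith
  · exact h4

/-- The set in which the orbits of interest live. -/
def trappingSet : Set (Fin 4 → ℝ) := closedRegion ∩ innerBox ∩ {X | -6 ≤ energy X}

theorem isClosed_trappingSet : IsClosed trappingSet :=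
  (isClosed_closedRegion.inter isCompact_innerBox.isClosed).inter
    (isClosed_le continuous_const continuous_energy)

theorem coord_eq_zero_of_norm_le_one {W : Fin 4 → ℝ} (hW : ‖W‖ ≤ 1)
    (h : Real.sin (2 * W 0) = 0) : W 0 = 0 := by
  have h3 := Real.pi_gt_three
  have h1 := abs_le.1 ((norm_le_pi_norm W 0).trans hW)
  have := (Real.sin_eq_zero_iff_of_lt_of_lt (by linarith) (by linarith)).1 h
  linarith

theorem tendsto_atBot_of_mem_trappingSet (hΦ : IsGlobalFlow truncField Φ)
    (hK : LipschitzWith K truncField) {x : Fin 4 → ℝ}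
    (hC : ∀ t, Φ x t ∈ trappingSet) (hnorm : ∀ t ≤ 0, ‖Φ x t‖ ≤ 1) :
    Tendsto (Φ x) atBot (𝓝 0) := by
  have hmono : Monotone fun t ↦ energy (Φ x t) := monotoneOn_univ.1 <|
    energy_monotoneOn convex_univ fun t _ ↦
      (hΦ.hasDerivAt_phaseField (hC t).1.2).self_of_nhds
  have hlim := tendsto_atBot_ciInf hmono ⟨-6, by
    rintro _ ⟨t, rfl⟩
    exact (hC t).2⟩
  refine isCompact_innerBox.le_nhds_of_unique_clusterPt
    (mem_map.2 (univ_mem' fun t ↦ (hC t).1.2)) fun W _ hW ↦ ?_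
  have hW1 : W ∈ Metric.closedBall (0 : Fin 4 → ℝ) 1 := MapClusterPt.mem_of_eventually hW
    Metric.isClosed_closedBall ((eventually_le_atBot 0).mono fun t ht ↦ by simpa using hnorm t ht)
  obtain ⟨h1, h2, h3, h4, -⟩ := equilibrium_of_mapClusterPt hΦ hK
    (fun s ↦ tendsto_atBot_add_const_right _ s tendsto_id) (.of_forall fun t ↦ (hC t).1.2) hlim hW
  ext i
  fin_cases i
  exacts [coord_eq_zero_of_norm_le_one (by simpa using hW1) h4, h1, h2, h3]

/-! ### The connecting orbit -/

theorem exists_orbit_from_time (hΦ : IsGlobalFlow truncField Φ) (hK : LipschitzWith K truncField)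
    (n : ℕ) : ∃ W, ‖W‖ = 1 ∧ (∀ t, -(n : ℝ) ≤ t → Φ W t ∈ trappingSet) ∧
      ∀ t, -(n : ℝ) ≤ t → t ≤ 0 → ‖Φ W t‖ ≤ 1 := by
  -- The arc has norm at most 8d and orbits separate from 0 at rate at most K, so up to time n the
  -- norm is at most 1/2.
  set d : ℝ := Real.exp (-(K * n)) / 16
  have hd : 0 < d := by positivity
  have hd1 : d ≤ 1 / 2 := by
    have : Real.exp (-(K * n : ℝ)) ≤ 1 := Real.exp_le_one_iff.2 (neg_nonpos.2 (by positivity))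
    simp only [d]; linarith
  obtain ⟨τ, hτ, hstay⟩ := exists_forall_mem_openRegion hΦ hK hd hd1
  have hC : ∀ t, 0 ≤ t → Φ (arc d τ) t ∈ closedRegion := fun t ht ↦ openRegion_subset (hstay t ht)
  have hbox : ∀ t, 0 ≤ t → Φ (arc d τ) t ∈ innerBox := fun t ht ↦
    hΦ.arc_mem_innerBox hd hd1 hτ (fun s hs ↦ hC s hs.1) t ⟨ht, le_rfl⟩
  have hE := energy_arc hd hd1 hτ
  have hmono : MonotoneOn (fun t ↦ energy (Φ (arc d τ) t)) (Set.Ici 0) :=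
    energy_monotoneOn (convex_Ici 0) fun t ht ↦
      (hΦ.hasDerivAt_phaseField (hbox t ht)).self_of_nhds
  have htrap : ∀ t, 0 ≤ t → Φ (arc d τ) t ∈ trappingSet := fun t ht ↦ by
    refine ⟨⟨hC t ht, hbox t ht⟩, ?_⟩
    have := hmono (Set.mem_Ici.2 le_rfl) (Set.mem_Ici.2 ht) ht
    simp only [hΦ.zero] at this
    exact hE.le.trans this
  have hlim := tendsto_atTop_of_mem_closedRegion hΦ hK hE hC hbox
  have hcont : Continuous fun t ↦ ‖Φ (arc d τ) t‖ := (hΦ.continuous _).norm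
  let large : Set ℝ := {t | 0 ≤ t ∧ 1 ≤ ‖Φ (arc d τ) t‖}
  have hlarge : large.Nonempty := by
    have h1 : 1 < ‖(![Real.pi / 2, 0, 0, 0] : Fin 4 → ℝ)‖ := by
      refine lt_of_lt_of_le ?_ (norm_le_pi_norm _ 0)
      simp only [Matrix.cons_val, Real.norm_eq_abs]
      exact lt_abs.2 (.inl (by linarith [Real.pi_gt_three]))
    obtain ⟨t, ht, ht0⟩ := ((hlim.norm.eventually (lt_mem_nhds h1)).and
      (eventually_ge_atTop 0)).exists
    exact ⟨t, ht0, ht.le⟩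
  have hbdd : BddBelow large := ⟨0, fun t ht ↦ ht.1⟩
  have hclosed : IsClosed large := isClosed_Ici.inter (isClosed_le continuous_const hcont)
  set T := sInf large
  have hT : T ∈ large := hclosed.csInf_mem hlarge hbdd
  have hlt : ∀ t, 0 ≤ t → t < T → ‖Φ (arc d τ) t‖ < 1 := fun t ht htT ↦ by
    by_contra! h
    exact (csInf_le hbdd ⟨ht, h⟩).not_gt htT
  have hsmall : ∀ t : ℝ, 0 ≤ t → t ≤ n → ‖Φ (arc d τ) t‖ < 1 := fun t ht htn ↦ by
    have h1 := hΦ.dist_le hK (arc d τ) 0 t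
    rw [hΦ.apply_zero_left hK, dist_zero_right, dist_zero_right, abs_of_nonneg ht] at h1
    calc ‖Φ (arc d τ) t‖ ≤ ‖arc d τ‖ * Real.exp (K * t) := h1
      _ ≤ 8 * d * Real.exp (K * n) := by
        gcongr
        exact norm_arc_le hd hd1 hτ
      _ = 1 / 2 := by
        simp only [d]
        rw [Real.exp_neg]
        field_simp
        norm_num
      _ < 1 := by norm_num
  have hTn : (n : ℝ) < T := by
    by_contra! h
    exact (hsmall T hT.1 h).not_ge hT.2
  have hT1 : ‖Φ (arc d τ) T‖ = 1 := by
    refine le_antisymm (le_of_tendsto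
      (hcont.continuousAt.continuousWithinAt : Tendsto _ (𝓝[<] T) _) ?_) hT.2
    filter_upwards [Ioo_mem_nhdsLT ((Nat.cast_nonneg n).trans_lt hTn)] with t ht
    exact (hlt t ht.1.le ht.2).le
  -- T is the first time of norm 1, and T > n; restarting there leaves at least n units of past.
  refine ⟨Φ (arc d τ) T, hT1, fun t ht ↦ ?_, fun t ht ht0 ↦ ?_⟩
  · rw [← hΦ.add hK]
    exact htrap _ (by linarith)
  · rw [← hΦ.add hK]
    rcases ht0.eq_or_lt with rfl | ht0
    · rw [add_zero, hT1]
    · exact (hlt _ (by linarith) (by linarith)).le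

/-- Cantor intersection for the nested compact sets of admissible points with past of length n. The
normalisation to norm 1 prevents collapse to the origin. -/
theorem exists_entire_orbit (hΦ : IsGlobalFlow truncField Φ) (hK : LipschitzWith K truncField) :
    ∃ W, ‖W‖ = 1 ∧ (∀ t, Φ W t ∈ trappingSet) ∧ ∀ t ≤ 0, ‖Φ W t‖ ≤ 1 := by
  let S : ℕ → Set (Fin 4 → ℝ) := fun n ↦ {W | ‖W‖ = 1 ∧
    (∀ t, -(n : ℝ) ≤ t → Φ W t ∈ trappingSet) ∧ ∀ t, -(n : ℝ) ≤ t → t ≤ 0 → ‖Φ W t‖ ≤ 1}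
  have hc := hΦ.continuous_left hK
  have hclosed : ∀ n, IsClosed (S n) := fun n ↦ by
    simp only [S, Set.ofPred_and, Set.ofPred_forall]
    refine (isClosed_eq continuous_norm continuous_const).inter (.inter ?_ ?_)
    · exact isClosed_iInter fun t ↦ isClosed_iInter fun _ ↦ isClosed_trappingSet.preimage (hc t)
    · exact isClosed_iInter fun t ↦ isClosed_iInter fun _ ↦ isClosed_iInter fun _ ↦
        isClosed_le (hc t).norm continuous_const
  have hcompact : IsCompact (S 0) := isCompact_innerBox.of_isClosed_subset (hclosed 0)
    fun W hW ↦ by simpa [hΦ.zero] using (hW.2.1 0 (by simp)).1.2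
  obtain ⟨W, hW⟩ := IsCompact.nonempty_iInter_of_sequence_nonempty_isCompact_isClosed S
    (fun n W hW ↦ ⟨hW.1, fun t ht ↦ hW.2.1 t (by push_cast; linarith),
      fun t ht ↦ hW.2.2 t (by push_cast; linarith)⟩)
    (exists_orbit_from_time hΦ hK) hcompact hclosed
  rw [Set.mem_iInter] at hW
  have hn : ∀ t : ℝ, ∃ n : ℕ, -(n : ℝ) ≤ t := fun t ↦ by
    obtain ⟨n, hn⟩ := exists_nat_ge (-t)
    exact ⟨n, by linarith⟩
  refine ⟨W, (hW 0).1, fun t ↦ ?_, fun t ht ↦ ?_⟩ <;> obtain ⟨n, hn⟩ := hn t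
  · exact (hW n).2.1 t hn
  · exact (hW n).2.2 t hn ht

/-- The limit preserves only the weak inequality. If level -6 were attained, the energy would be
constant at all earlier times, making the orbit an equilibrium in the unit ball, that is, the
origin. -/
theorem energy_gt_of_mem_trappingSet (hΦ : IsGlobalFlow truncField Φ)
    (hK : LipschitzWith K truncField) {W : Fin 4 → ℝ} (hW : W ≠ 0)
    (hC : ∀ t, Φ W t ∈ trappingSet) (hnorm : ∀ t ≤ 0, ‖Φ W t‖ ≤ 1) (t : ℝ) :
    -6 < energy (Φ W t) := by
  by_contra! h
  have hmono : Monotone fun t ↦ energy (Φ W t) := monotoneOn_univ.1 <|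
    energy_monotoneOn convex_univ fun t _ ↦
      (hΦ.hasDerivAt_phaseField (hC t).1.2).self_of_nhds
  -- Strictly before t, so the energy is -6 near s, and at most 0, so the norm bound applies.
  set s := min t 0 - 1
  have hs : s < t := by linarith [min_le_left t 0]
  have hs0 : s ≤ 0 := by linarith [min_le_right t 0]
  obtain ⟨h1, h2, h3, h4⟩ := equilibrium_of_energy_eq (e := -6)
    (hΦ.hasDerivAt_phaseField (hC s).1.2) (by
      filter_upwards [gt_mem_nhds hs] with r hr
      exact le_antisymm ((hmono hr.le).trans h) (hC r).2)
  have hzero : Φ W s = 0 := by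
    ext i
    fin_cases i
    exacts [coord_eq_zero_of_norm_le_one (hnorm s hs0) h4, h1, h2, h3]
  refine hW ?_
  rw [← hΦ.zero W, ← add_neg_cancel s, hΦ.add hK, hzero, hΦ.apply_zero_left hK]

end Limits

/-! ### Smoothness and return to the scalar equation -/

theorem contDiff_of_hasDerivAt_comp {E : Type*} [NormedAddCommGroup E] [NormedSpace ℝ E]
    {v : E → E} (hv : ContDiff ℝ ∞ v) {X : ℝ → E} (hX : ∀ t, HasDerivAt X (v (X t)) t) :
    ContDiff ℝ ∞ X := by
  rw [contDiff_infty]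
  intro n
  induction n with
  | zero => exact contDiff_zero.2 (continuous_iff_continuousAt.2 fun t ↦ (hX t).continuousAt)
  | succ n ih =>
    have hd : deriv X = v ∘ X := funext fun t ↦ (hX t).deriv
    push_cast
    refine contDiff_succ_iff_deriv.2 ⟨fun t ↦ (hX t).differentiableAt, by simp, ?_⟩
    rw [hd]
    exact (hv.of_le (by exact_mod_cast le_top)).comp ih

theorem iteratedDeriv_coord {X : ℝ → Fin 4 → ℝ} (hX : ∀ t, HasDerivAt X (phaseField (X t)) t) :
    iteratedDeriv 1 (fun t ↦ X t 0) = (fun t ↦ X t 1) ∧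
    iteratedDeriv 2 (fun t ↦ X t 0) = (fun t ↦ X t 2) ∧
    iteratedDeriv 3 (fun t ↦ X t 0) = (fun t ↦ X t 3) ∧
    iteratedDeriv 4 (fun t ↦ X t 0) =
      fun t ↦ fourthOrderRHS (X t 0) (X t 1) (X t 2) (X t 3) := by
  have h1 : iteratedDeriv 1 (fun t ↦ X t 0) = fun t ↦ X t 1 := by
    rw [iteratedDeriv_one]; exact funext fun t ↦ (hasDerivAt_coord (hX t)).1.deriv
  have h2 : iteratedDeriv 2 (fun t ↦ X t 0) = fun t ↦ X t 2 := by
    rw [iteratedDeriv_succ, h1]; exact funext fun t ↦ (hasDerivAt_coord (hX t)).2.1.deriv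
  have h3 : iteratedDeriv 3 (fun t ↦ X t 0) = fun t ↦ X t 3 := by
    rw [iteratedDeriv_succ, h2]; exact funext fun t ↦ (hasDerivAt_coord (hX t)).2.2.1.deriv
  refine ⟨h1, h2, h3, ?_⟩
  rw [iteratedDeriv_succ, h3]; exact funext fun t ↦ (hasDerivAt_coord (hX t)).2.2.2.deriv

theorem mainTheorem5 :
    ∃ φ : ℝ → ℝ, ContDiff ℝ ∞ φ ∧ IsEntireSolution φ ∧
      (∀ s : ℝ, phaseCurve φ s ∈ unstableManifold phaseField 0) ∧
      (∀ s : ℝ, (φ s, iteratedDeriv 2 φ s) ∈ regionC) ∧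
      Tendsto (phaseCurve φ) atTop (𝓝 ![Real.pi / 2, 0, 0, 0]) := by
  obtain ⟨K, hK⟩ := exists_lipschitzWith_truncField
  obtain ⟨L, hL⟩ := exists_bound_truncField
  obtain ⟨Φ, hΦ⟩ := exists_isGlobalFlow hK hL
  obtain ⟨W, hW, hC, hnorm⟩ := exists_entire_orbit hΦ hK
  have hsol : ∀ t, HasDerivAt (Φ W) (phaseField (Φ W t)) t := fun t ↦
    (hΦ.hasDerivAt_phaseField (hC t).1.2).self_of_nhds
  have hE := energy_gt_of_mem_trappingSet hΦ hK (norm_ne_zero_iff.1 (hW ▸ one_ne_zero)) hC hnorm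
  obtain ⟨h1, h2, h3, h4⟩ := iteratedDeriv_coord hsol
  have hcurve : phaseCurve (fun t ↦ Φ W t 0) = Φ W := by
    ext t i
    rw [phaseCurve, h1, h2, h3]
    fin_cases i <;> rfl
  refine ⟨fun t ↦ Φ W t 0, ?_, fun s ↦ ?_, fun s ↦ ?_, fun s ↦ ?_, ?_⟩
  · exact contDiff_pi.1 (contDiff_of_hasDerivAt_comp contDiff_phaseField hsol) 0
  · rw [h1, h2, h3, h4]
  · rw [hcurve]
    refine ⟨fun t ↦ Φ W (s + t), by simp, fun t _ ↦ ?_, ?_⟩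
    · exact (HasDerivAt.comp_const_add s t (hsol (s + t))).hasDerivWithinAt
    · exact (tendsto_atBot_of_mem_trappingSet hΦ hK hC hnorm).comp
        (tendsto_atBot_add_const_left _ s tendsto_id)
  · rw [h2]
    -- Compactness gave only the closed region; a boundary contact would force immediate exit.
    exact mem_openRegion_of_eventually (.of_forall hsol) (hE s) (.of_forall fun t ↦ (hC t).1.1)
  · rw [hcurve]
    refine tendsto_atTop_of_mem_closedRegion hΦ hK ?_ (fun t _ ↦ (hC t).1.1) fun t _ ↦ (hC t).1.2
    simpa [hΦ.zero] using hE 0
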